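/- Let $\mathcal V$ be a symmetric monoidal closed category whose underlying ordinary category $\mathcal V_0$ is locally small, complete and cocomplete; categories, functors and natural transformations are $\mathcal V$-enriched. A weight is a functor $\phi:\mathcal K^{op}\to\mathcal V$ with $\mathcal K$ small. For $S:\mathcal K\to\mathcal A$, the $\phi$-weighted colimit $\phi*S$, if it exists, is an object of $\mathcal A$ together with a natural transformation $\phi\to\mathcal A(S-,\phi*S)$ that induces isomorphisms $\mathcal A(\phi*S,a)\cong[\mathcal K^{op},\mathcal V](\phi,\mathcal A(S-,a))$ in $\mathcal V$ for all $a\in\mathcal A$. A functor $F:\mathcal A\to\mathcal B$ preserves $\phi*S$ if $F(\phi*S)$, with the composite $\phi\to\mathcal A(S-,\phi*S)\to\mathcal B(FS-,F(\phi*S))$, is the $\phi$-weighted colimit of $FS$. For a class $\Phi$ of weights and a category $\mathcal A$ (not necessarily small, nor assumed to admit any colimits), let $\mathcal A_\Phi$ be the full subcategory of $\mathcal A$ on the $\Phi$-atoms, i.e. those $a\in\mathcal A$ for which the representable $\mathcal A(a,-):\mathcal A\to\mathcal V$ preserves all $\Phi$-colimits that exist in $\mathcal A$. Let $\Phi^-$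 be the class of all weights $\psi:\mathcal K^{op}\to\mathcal V$ such that $\Phi$-colimits commute with $\psi$-limits in $\mathcal V$, i.e. such that the $\psi$-weighted limit functor $\{\psi,-\}=[\mathcal K^{op},\mathcal V](\psi,-):[\mathcal K^{op},\mathcal V]\to\mathcal V$ preserves $\phi$-colimits for every $\phi\in\Phi$. **Proposition.** For any class $\Phi$ of weights and any category $\mathcal A$, the full subcategory $\mathcal A_\Phi$ is closed in $\mathcal A$ under those $\Phi^-$-colimits that exist in $\mathcal A$: if $\psi:\mathcal K^{op}\to\mathcal V$ lies in $\Phi^-$, if $S:\mathcal K\to\mathcal A$ takes its values in $\mathcal A_\Phi$, and if the colimit $\psi*S$ exists in $\mathcal A$, then $\psi*S$ lies in $\mathcal A_\Phi$. -/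

import Mathlib

open CategoryTheory MonoidalCategory Limits

open scoped CategoryTheory.MonoidalClosed

universe w v u u₂

set_option linter.unusedSectionVars false

namespace VCat

noncomputable section

section Prelim

variable {V : Type v} [Category.{w} V] [MonoidalCategory V]
variable {D : Type u} [EnrichedCategory V D]

lemma tensorHom_eId_comp {A B : D} {P : V} (f : P ⟶ (A ⟶[V] B)) :
    (f ⊗ₘ eId V B) ≫ eComp V _ _ _ = (ρ_ _).hom ≫ f := by
  have := e_comp_id V A B
  rw [Iso.inv_comp_eq, Category.comp_id] at this
  rw [MonoidalCategory.tensorHom_def, Category.assoc, this, rightUnitor_naturality]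

lemma eId_tensorHom_comp {A B : D} {P : V} (f : P ⟶ (A ⟶[V] B)) :
    (eId V A ⊗ₘ f) ≫ eComp V _ _ _ = (λ_ _).hom ≫ f := by
  have := e_id_comp V A B
  rw [Iso.inv_comp_eq, Category.comp_id] at this
  rw [MonoidalCategory.tensorHom_def', Category.assoc, this, leftUnitor_naturality]

lemma tensorHom_comp_assoc {A₁ A₂ A₃ A₄ : D} {P Q R : V} (f : P ⟶ (A₁ ⟶[V] A₂))
    (g : Q ⟶ (A₂ ⟶[V] A₃)) (h : R ⟶ (A₃ ⟶[V] A₄)) :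
    (f ⊗ₘ ((g ⊗ₘ h) ≫ eComp V _ _ _)) ≫ eComp V _ _ _ =
      (α_ _ _ _).inv ≫ (((f ⊗ₘ g) ≫ eComp V _ _ _) ⊗ₘ h) ≫ eComp V _ _ _ := by
  have h1 : (f ⊗ₘ ((g ⊗ₘ h) ≫ eComp V A₂ A₃ A₄)) =
      (f ⊗ₘ (g ⊗ₘ h)) ≫ _ ◁ eComp V A₂ A₃ A₄ := by
    rw [← id_tensorHom, tensorHom_comp_tensorHom, Category.comp_id]
  have h2 : (((f ⊗ₘ g) ≫ eComp V A₁ A₂ A₃) ⊗ₘ h) =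
      ((f ⊗ₘ g) ⊗ₘ h) ≫ eComp V A₁ A₂ A₃ ▷ _ := by
    rw [← tensorHom_id, tensorHom_comp_tensorHom, Category.comp_id]
  rw [h1, h2, Category.assoc, Category.assoc, ← e_assoc, associator_inv_naturality_assoc]

end Prelim

/-! ## The `V`-category of `V`-functors `C → D`, for `C` small

Here and below "small" means that the objects form a type in the universe `w` of the hom-sets
of `V`. -/

section FunctorCategory

variable {V : Type v} [Category.{w} V] [MonoidalCategory V] [SymmetricCategory V]
  [MonoidalClosed V]
variable {C : Type w} [EnrichedCategory V C] {D : Type u} [EnrichedCategory V D]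

/-- The `(X, Y)`-component of the action of `F` on `D(F Y, G Y)`: the transpose of
`C(X, Y) ⊗ D(F Y, G Y) ⟶ D(F X, F Y) ⊗ D(F Y, G Y) ⟶ D(F X, G Y)`. -/
def precompMap (F G : EnrichedFunctor V C D) (X Y : C) :
    (F.obj Y ⟶[V] G.obj Y) ⟶ (ihom (X ⟶[V] Y)).obj (F.obj X ⟶[V] G.obj Y) :=
  MonoidalClosed.curry (F.map X Y ▷ _ ≫ eComp V _ _ _)

/-- The `(X, Y)`-component of the action of `G` on `D(F X, G X)`: the transpose of
`C(X, Y) ⊗ D(F X, G X) ≅ D(F X, G X) ⊗ C(X, Y) ⟶ D(F X, G X) ⊗ D(G X, G Y) ⟶ D(F X, G Y)`. -/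
def postcompMap (F G : EnrichedFunctor V C D) (X Y : C) :
    (F.obj X ⟶[V] G.obj X) ⟶ (ihom (X ⟶[V] Y)).obj (F.obj X ⟶[V] G.obj Y) :=
  MonoidalClosed.curry ((β_ _ _).hom ≫ _ ◁ G.map X Y ≫ eComp V _ _ _)

/-- A family `α X : Q ⟶ D(F X, G X)` is `V`-natural in `X` (for `Q = 𝟙_ V` this is the notion of
a `V`-natural transformation `F ⟶ G`): the two morphisms `C(X, Y) ⊗ Q ⟶ D(F X, G Y)` agree. -/
def IsVNatural (F G : EnrichedFunctor V C D) {Q : V} (α : ∀ X, Q ⟶ (F.obj X ⟶[V] G.obj X)) :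
    Prop :=
  ∀ X Y : C, (F.map X Y ⊗ₘ α Y) ≫ eComp V _ _ _ =
    (β_ _ _).hom ≫ (α X ⊗ₘ G.map X Y) ≫ eComp V _ _ _

lemma isVNatural_iff (F G : EnrichedFunctor V C D) {Q : V}
    (α : ∀ X, Q ⟶ (F.obj X ⟶[V] G.obj X)) :
    IsVNatural F G α ↔ ∀ X Y, α Y ≫ precompMap F G X Y = α X ≫ postcompMap F G X Y := by
  have h1 : ∀ X Y, α Y ≫ precompMap F G X Y =
      MonoidalClosed.curry ((F.map X Y ⊗ₘ α Y) ≫ eComp V _ _ _) := fun X Y => by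
    rw [precompMap, ← MonoidalClosed.curry_natural_left, MonoidalCategory.tensorHom_def',
      Category.assoc]
  have h2 : ∀ X Y, α X ≫ postcompMap F G X Y =
      MonoidalClosed.curry ((β_ _ _).hom ≫ (α X ⊗ₘ G.map X Y) ≫ eComp V _ _ _) := fun X Y => by
    rw [postcompMap, ← MonoidalClosed.curry_natural_left,
      BraidedCategory.braiding_naturality_right_assoc, MonoidalCategory.tensorHom_def,
      Category.assoc]
  constructor
  · intro h X Y
    rw [h1, h2, h X Y]
  · intro h X Y
    apply MonoidalClosed.curry_injective
    rw [← h1, ← h2, h X Y]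

lemma isVNatural_id (F : EnrichedFunctor V C D) :
    IsVNatural F F (fun X => eId V (F.obj X)) := by
  intro X Y
  rw [tensorHom_eId_comp, eId_tensorHom_comp, braiding_leftUnitor_assoc]

lemma isVNatural_comp {F G H : EnrichedFunctor V C D} {Q R : V}
    {α : ∀ X, Q ⟶ (F.obj X ⟶[V] G.obj X)} {β : ∀ X, R ⟶ (G.obj X ⟶[V] H.obj X)}
    (hα : IsVNatural F G α) (hβ : IsVNatural G H β) :
    IsVNatural F H (fun X => (α X ⊗ₘ β X) ≫ eComp V _ _ _) := by
  intro X Y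
  have h1 : ∀ {P P' Q' : V} (a : P ⟶ P') (b : P' ⟶ (F.obj X ⟶[V] G.obj Y))
      (c : Q' ⟶ (G.obj Y ⟶[V] H.obj Y)), ((a ≫ b) ⊗ₘ c) = a ▷ _ ≫ (b ⊗ₘ c) := by
    intros
    rw [← tensorHom_id, tensorHom_comp_tensorHom, Category.id_comp]
  have h2 : ∀ {P P' Q' : V} (a : P ⟶ P') (b : P' ⟶ (G.obj X ⟶[V] H.obj Y))
      (c : Q' ⟶ (F.obj X ⟶[V] G.obj X)), (c ⊗ₘ (a ≫ b)) = _ ◁ a ≫ (c ⊗ₘ b) := by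
    intros
    rw [← id_tensorHom, tensorHom_comp_tensorHom, Category.id_comp]
  have h3 : (((α X ⊗ₘ G.map X Y) ≫ eComp V _ _ _) ⊗ₘ β Y) ≫ eComp V _ _ _ =
      (α_ _ _ _).hom ≫ (α X ⊗ₘ ((G.map X Y ⊗ₘ β Y) ≫ eComp V _ _ _)) ≫ eComp V _ _ _ := by
    rw [tensorHom_comp_assoc, Iso.hom_inv_id_assoc]
  have h4 : (((α X ⊗ₘ β X) ≫ eComp V _ _ _) ⊗ₘ H.map X Y) ≫ eComp V _ _ _ =
      (α_ _ _ _).hom ≫ (α X ⊗ₘ ((β X ⊗ₘ H.map X Y) ≫ eComp V _ _ _)) ≫ eComp V _ _ _ := by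
    rw [tensorHom_comp_assoc, Iso.hom_inv_id_assoc]
  rw [tensorHom_comp_assoc, hα X Y, h1, Category.assoc, h3, hβ X Y, h2, h4,
    BraidedCategory.braiding_tensor_right_hom]
  simp only [Category.assoc, Iso.inv_hom_id_assoc]

lemma IsVNatural.comp_left {F G : EnrichedFunctor V C D} {Q R : V}
    {α : ∀ X, Q ⟶ (F.obj X ⟶[V] G.obj X)} (hα : IsVNatural F G α) (f : R ⟶ Q) :
    IsVNatural F G (fun X => f ≫ α X) := by
  rw [isVNatural_iff] at hα ⊢
  intro X Y
  rw [Category.assoc, Category.assoc, hα]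

variable [HasLimits V]

/-- The object `[C, D](F, G) = ∫_X D(F X, G X)` of `V`-natural transformations, as the equalizer
of `∏_X D(F X, G X) ⇉ ∏_{X, Y} [C(X, Y), D(F X, G Y)]`. -/
def natHom (F G : EnrichedFunctor V C D) : V :=
  equalizer
    (Pi.lift fun p : C × C => Pi.π (fun X => (F.obj X ⟶[V] G.obj X : V)) p.2 ≫
      precompMap F G p.1 p.2)
    (Pi.lift fun p : C × C => Pi.π (fun X => (F.obj X ⟶[V] G.obj X : V)) p.1 ≫
      postcompMap F G p.1 p.2)

/-- The inclusion of `[C, D](F, G)` into the product `∏_X D(F X, G X)`. -/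
def natHomι (F G : EnrichedFunctor V C D) :
    natHom F G ⟶ ∏ᶜ fun X => (F.obj X ⟶[V] G.obj X : V) :=
  equalizer.ι _ _

/-- The component of `[C, D](F, G)` at `X`. -/
def natHomπ (F G : EnrichedFunctor V C D) (X : C) : natHom F G ⟶ (F.obj X ⟶[V] G.obj X) :=
  natHomι F G ≫ Pi.π (fun X => (F.obj X ⟶[V] G.obj X : V)) X

lemma natHomπ_isVNatural (F G : EnrichedFunctor V C D) : IsVNatural F G (natHomπ F G) := by
  rw [isVNatural_iff]
  intro X Y
  have h : natHomι F G ≫ (Pi.lift fun p : C × C =>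
        Pi.π (fun X => (F.obj X ⟶[V] G.obj X : V)) p.2 ≫ precompMap F G p.1 p.2) =
      natHomι F G ≫ (Pi.lift fun p : C × C =>
        Pi.π (fun X => (F.obj X ⟶[V] G.obj X : V)) p.1 ≫ postcompMap F G p.1 p.2) :=
    equalizer.condition _ _
  simpa [natHomπ] using h =≫ Pi.π _ (X, Y)

/-- The universal property of `[C, D](F, G)`: existence. -/
def natHomLift (F G : EnrichedFunctor V C D) {Q : V} (α : ∀ X, Q ⟶ (F.obj X ⟶[V] G.obj X))
    (hα : IsVNatural F G α) : Q ⟶ natHom F G :=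
  equalizer.lift (Pi.lift α) (by
    rw [isVNatural_iff] at hα
    apply Pi.hom_ext
    rintro ⟨X, Y⟩
    simpa using hα X Y)

@[simp]
lemma natHomLift_π (F G : EnrichedFunctor V C D) {Q : V} (α : ∀ X, Q ⟶ (F.obj X ⟶[V] G.obj X))
    (hα : IsVNatural F G α) (X : C) : natHomLift F G α hα ≫ natHomπ F G X = α X := by
  have h : natHomLift F G α hα ≫ natHomι F G = Pi.lift α := equalizer.lift_ι _ _
  rw [natHomπ, ← Category.assoc, h, Pi.lift_π]

/-- The universal property of `[C, D](F, G)`: uniqueness. -/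
lemma natHom_ext {F G : EnrichedFunctor V C D} {Q : V} {f g : Q ⟶ natHom F G}
    (h : ∀ X, f ≫ natHomπ F G X = g ≫ natHomπ F G X) : f = g := by
  have h' : f ≫ natHomι F G = g ≫ natHomι F G := by
    apply Pi.hom_ext
    intro X
    simpa [natHomπ] using h X
  exact equalizer.hom_ext h'

/-- Composition `[C, D](F, G) ⊗ [C, D](G, H) ⟶ [C, D](F, H)`, given componentwise by composition
in `D`. -/
def natHomComp (F G H : EnrichedFunctor V C D) : natHom F G ⊗ natHom G H ⟶ natHom F H :=
  natHomLift F H (fun X => (natHomπ F G X ⊗ₘ natHomπ G H X) ≫ eComp V _ _ _)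
    (isVNatural_comp (natHomπ_isVNatural F G) (natHomπ_isVNatural G H))

/-- The `V`-functor category `[C, D]`, for `C` small. -/
instance functorCategory : EnrichedCategory V (EnrichedFunctor V C D) where
  Hom F G := natHom F G
  id F := natHomLift F F (fun X => eId V (F.obj X)) (isVNatural_id F)
  comp F G H := natHomComp F G H
  id_comp F G := by
    apply natHom_ext
    intro X
    rw [Category.assoc, Category.assoc, natHomComp, natHomLift_π, MonoidalCategory.tensorHom_def,
      Category.assoc, ← comp_whiskerRight_assoc, natHomLift_π,
      ← MonoidalCategory.tensorHom_def_assoc, eId_tensorHom_comp, Iso.inv_hom_id_assoc,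
      Category.id_comp]
  comp_id F G := by
    apply natHom_ext
    intro X
    rw [Category.assoc, Category.assoc, natHomComp, natHomLift_π, MonoidalCategory.tensorHom_def',
      Category.assoc, ← MonoidalCategory.whiskerLeft_comp_assoc, natHomLift_π,
      ← MonoidalCategory.tensorHom_def'_assoc, tensorHom_eId_comp, Iso.inv_hom_id_assoc,
      Category.id_comp]
  assoc F G H K := by
    apply natHom_ext
    intro X
    simp only [Category.assoc, natHomComp, natHomLift_π]
    rw [MonoidalCategory.tensorHom_def, Category.assoc, ← comp_whiskerRight_assoc, natHomLift_π,
      ← MonoidalCategory.tensorHom_def_assoc, ← tensorHom_comp_assoc,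
      MonoidalCategory.tensorHom_def' (natHomπ F G X) (natHomπ G K X),
      Category.assoc, ← MonoidalCategory.whiskerLeft_comp_assoc, natHomLift_π,
      ← MonoidalCategory.tensorHom_def'_assoc]

end FunctorCategory

/-! ## Representables, weights and weighted colimits -/

section Weighted

variable {V : Type v} [Category.{w} V] [MonoidalCategory V] [SymmetricCategory V]
  [MonoidalClosed V]

lemma uncurry_eId (x : V) : MonoidalClosed.uncurry (eId V x) = (ρ_ x).hom :=
  MonoidalClosed.uncurry_curry _

/-- The transpose of a composite in `V`, regarded as a `V`-category. -/
lemma uncurry_tensorHom_comp {P Q x y z : V} (f : P ⟶ (ihom x).obj y) (g : Q ⟶ (ihom y).obj z) :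
    MonoidalClosed.uncurry ((f ⊗ₘ g) ≫ eComp V x y z) =
      (α_ _ _ _).inv ≫ MonoidalClosed.uncurry f ▷ Q ≫ MonoidalClosed.uncurry g := by
  have h : MonoidalClosed.uncurry ((f ⊗ₘ g) ≫ eComp V x y z) =
      x ◁ (f ⊗ₘ g) ≫ MonoidalClosed.compTranspose x y z := by
    rw [MonoidalClosed.uncurry_natural_left]
    congr 1
    exact MonoidalClosed.uncurry_curry _
  have h' : (x ⊗ (ihom x).obj y) ◁ g ≫ (ihom.ev x).app y ▷ _ =
      (ihom.ev x).app y ▷ Q ≫ y ◁ g := whisker_exchange _ _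
  rw [h, MonoidalClosed.compTranspose, MonoidalClosed.uncurry_eq, MonoidalClosed.uncurry_eq,
    MonoidalCategory.tensorHom_def, MonoidalCategory.whiskerLeft_comp, Category.assoc,
    associator_inv_naturality_right_assoc, associator_inv_naturality_middle_assoc,
    comp_whiskerRight]
  congr 1
  rw [Category.assoc]
  congr 1
  exact (Category.assoc _ _ _).symm.trans ((congrArg (fun t => t ≫ (ihom.ev y).app z) h').trans
    (Category.assoc _ _ _))

/-- The covariant representable `V`-functor `A(a, -) : A → V`, whose action on homs is the
transpose of the composition `A(a, x) ⊗ A(x, y) ⟶ A(a, y)`. -/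
def representable {A : Type u} [EnrichedCategory V A] (a : A) : EnrichedFunctor V A V where
  obj x := (a ⟶[V] x)
  map x y := MonoidalClosed.curry (eComp V a x y)
  map_id x := by
    apply MonoidalClosed.uncurry_injective
    rw [MonoidalClosed.uncurry_natural_left, MonoidalClosed.uncurry_curry, uncurry_eId,
      ← id_tensorHom, tensorHom_eId_comp, Category.comp_id]
  map_comp x y z := by
    apply MonoidalClosed.uncurry_injective
    rw [MonoidalClosed.uncurry_natural_left, MonoidalClosed.uncurry_curry, uncurry_tensorHom_comp,
      MonoidalClosed.uncurry_curry, MonoidalClosed.uncurry_curry, ← e_assoc]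

section

variable {K : Type w} [EnrichedCategory V K] {A : Type u} [EnrichedCategory V A]

lemma braiding_hexagon (P Q R : V) :
    P ◁ (β_ Q R).hom ≫ (β_ P (R ⊗ Q)).hom ≫ (α_ R Q P).hom =
      (α_ P Q R).inv ≫ (β_ P Q).hom ▷ R ≫ (β_ (Q ⊗ P) R).hom := by
  rw [BraidedCategory.braiding_naturality_left, BraidedCategory.braiding_tensor_left_hom,
    BraidedCategory.braiding_tensor_right_hom]
  simp only [Category.assoc, Iso.inv_hom_id_assoc, Iso.inv_hom_id, Category.comp_id]

lemma braiding_hexagon' (P Q R : V) :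
    (α_ P Q R).inv ≫ (β_ P Q).hom ▷ R ≫ (α_ Q P R).hom =
      P ◁ (β_ Q R).hom ≫ (α_ P R Q).inv ≫ (β_ (P ⊗ R) Q).hom := by
  rw [BraidedCategory.braiding_tensor_left_hom]
  simp only [Iso.inv_hom_id_assoc]
  rw [← MonoidalCategory.whiskerLeft_comp_assoc, SymmetricCategory.symmetry]
  simp

/-- The action `A(S k, a) ⊗ K(l, k) ⟶ A(S l, a)`. -/
def presheafAct (S : EnrichedFunctor V K A) (a : A) (k l : K) :
    (S.obj k ⟶[V] a) ⊗ (l ⟶[V] k) ⟶ (S.obj l ⟶[V] a) :=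
  (β_ _ _).hom ≫ (S.map l k ⊗ₘ 𝟙 _) ≫ eComp V _ _ _

lemma presheafAct_id (S : EnrichedFunctor V K A) (a : A) (k : K) :
    _ ◁ eId V k ≫ presheafAct S a k k = (ρ_ _).hom := by
  rw [presheafAct, BraidedCategory.braiding_naturality_right_assoc, tensorHom_id,
    ← comp_whiskerRight_assoc, EnrichedFunctor.map_id, ← tensorHom_id, eId_tensorHom_comp,
    Category.comp_id, braiding_leftUnitor]

lemma presheafAct_comp (S : EnrichedFunctor V K A) (a : A) (k l m : K) :
    _ ◁ ((β_ _ _).hom ≫ eComp V m l k) ≫ presheafAct S a k m =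
      (α_ _ _ _).inv ≫ presheafAct S a k l ▷ _ ≫ presheafAct S a l m := by
  have h1 : ((eComp V m l k ≫ S.map m k) ⊗ₘ 𝟙 (S.obj k ⟶[V] a)) ≫ eComp V _ _ _ =
      (α_ _ _ _).hom ≫ (S.map m l ⊗ₘ ((S.map l k ⊗ₘ 𝟙 _) ≫ eComp V _ _ _)) ≫
        eComp V _ _ _ := by
    rw [EnrichedFunctor.map_comp, tensorHom_comp_assoc, Iso.hom_inv_id_assoc]
  have h2 : ∀ {P Q R : V} (f : P ⟶ Q) (g : Q ⟶ R) (T : V), (f ≫ g) ⊗ₘ 𝟙 T =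
      f ▷ T ≫ (g ⊗ₘ 𝟙 T) := by
    intros
    rw [tensorHom_id, tensorHom_id, comp_whiskerRight]
  have h3 : (S.map m l ⊗ₘ ((S.map l k ⊗ₘ 𝟙 (S.obj k ⟶[V] a)) ≫ eComp V _ _ _)) =
      _ ◁ ((S.map l k ⊗ₘ 𝟙 (S.obj k ⟶[V] a)) ≫ eComp V _ _ _) ≫ (S.map m l ⊗ₘ 𝟙 _) := by
    rw [← id_tensorHom, tensorHom_comp_tensorHom, Category.id_comp, Category.comp_id]
  rw [presheafAct, MonoidalCategory.whiskerLeft_comp, Category.assoc,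
    BraidedCategory.braiding_naturality_right_assoc, ← Category.assoc (eComp V m l k ▷ _),
    ← h2, h1, presheafAct, presheafAct, comp_whiskerRight, Category.assoc,
    BraidedCategory.braiding_naturality_left_assoc, h3, Category.assoc]
  simpa only [Category.assoc] using congrArg (fun t => t ≫
    _ ◁ ((S.map l k ⊗ₘ 𝟙 (S.obj k ⟶[V] a)) ≫ eComp V _ _ _) ≫
      (S.map m l ⊗ₘ 𝟙 _) ≫ eComp V _ _ _)
    (braiding_hexagon (S.obj k ⟶[V] a) (l ⟶[V] k) (m ⟶[V] l))

lemma presheafAct_natural (S : EnrichedFunctor V K A) (a b : A) (k l : K) :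
    (α_ _ _ _).inv ≫ presheafAct S a k l ▷ _ ≫ eComp V (S.obj l) a b =
      _ ◁ (β_ _ _).hom ≫ (α_ _ _ _).inv ≫ eComp V (S.obj k) a b ▷ _ ≫
        presheafAct S b k l := by
  have h1 : presheafAct S a k l ▷ (a ⟶[V] b) ≫ eComp V (S.obj l) a b =
      (β_ _ _).hom ▷ _ ≫ (α_ _ _ _).hom ≫ (S.map l k ⊗ₘ eComp V (S.obj k) a b) ≫
        eComp V _ _ _ := by
    have := tensorHom_comp_assoc (S.map l k) (𝟙 (S.obj k ⟶[V] a)) (𝟙 (a ⟶[V] b))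
    rw [id_tensorHom_id, Category.id_comp, tensorHom_id _ (a ⟶[V] b)] at this
    rw [this, Iso.hom_inv_id_assoc, presheafAct, comp_whiskerRight, Category.assoc]
  have h2 : eComp V (S.obj k) a b ▷ (l ⟶[V] k) ≫ presheafAct S b k l =
      (β_ _ _).hom ≫ (S.map l k ⊗ₘ eComp V (S.obj k) a b) ≫ eComp V _ _ _ := by
    rw [presheafAct, BraidedCategory.braiding_naturality_left_assoc, ← id_tensorHom,
      tensorHom_comp_tensorHom_assoc, Category.id_comp, Category.comp_id]
  rw [h1, h2]
  simpa only [Category.assoc] using congrArg (fun t => t ≫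
    (S.map l k ⊗ₘ eComp V (S.obj k) a b) ≫ eComp V _ _ _)
    (braiding_hexagon' (S.obj k ⟶[V] a) (l ⟶[V] k) (a ⟶[V] b))

/-- The presheaf `A(S-, a) : Kᵒᵖ → V`, whose action on homs is the transpose of
`A(S k, a) ⊗ K(l, k) ≅ K(l, k) ⊗ A(S k, a) ⟶ A(S l, S k) ⊗ A(S k, a) ⟶ A(S l, a)`. -/
def presheaf (S : EnrichedFunctor V K A) (a : A) : EnrichedFunctor V Kᵒᵖ V where
  obj k := (S.obj k.unop ⟶[V] a)
  map k l := MonoidalClosed.curry (presheafAct S a k.unop l.unop)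
  map_id k := by
    apply MonoidalClosed.uncurry_injective
    rw [uncurry_eId]
    exact (MonoidalClosed.uncurry_natural_left _ _).trans
      ((congrArg _ (MonoidalClosed.uncurry_curry _)).trans (presheafAct_id S a k.unop))
  map_comp k l m := by
    apply MonoidalClosed.uncurry_injective
    rw [uncurry_tensorHom_comp]
    refine (MonoidalClosed.uncurry_natural_left _ _).trans
      ((congrArg _ (MonoidalClosed.uncurry_curry _)).trans
        ((presheafAct_comp S a k.unop l.unop m.unop).trans ?_))
    rw [MonoidalClosed.uncurry_curry, MonoidalClosed.uncurry_curry]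
    rfl

lemma uncurry_presheaf_map (S : EnrichedFunctor V K A) (a : A) (k l : Kᵒᵖ) :
    MonoidalClosed.uncurry ((presheaf S a).map k l) = presheafAct S a k.unop l.unop :=
  MonoidalClosed.uncurry_curry _

/-- The morphism `A(a, b) ⟶ [A(S k, a), A(S k, b)]`, the transpose of composition in `A`. -/
def nerveApp (S : EnrichedFunctor V K A) (a b : A) (k : Kᵒᵖ) :
    (a ⟶[V] b) ⟶ (EnrichedCategory.Hom ((presheaf S a).obj k) ((presheaf S b).obj k) : V) :=
  (representable (S.obj k.unop)).map a b

lemma nerveApp_isVNatural (S : EnrichedFunctor V K A) (a b : A) :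
    IsVNatural (presheaf S a) (presheaf S b) (nerveApp S a b) := by
  intro k l
  apply MonoidalClosed.uncurry_injective
  have h : ∀ m : Kᵒᵖ, MonoidalClosed.uncurry (nerveApp S a b m) = eComp V (S.obj m.unop) a b :=
    fun m => MonoidalClosed.uncurry_curry _
  rw [uncurry_tensorHom_comp, MonoidalClosed.uncurry_natural_left, uncurry_tensorHom_comp,
    h, h, uncurry_presheaf_map, uncurry_presheaf_map]
  exact presheafAct_natural S a b k.unop l.unop

end

variable [HasLimits V]

/-- The action `A(a, b) ⟶ [Kᵒᵖ, V](A(S-, a), A(S-, b))` on homs of the `V`-functor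
`a ↦ A(S-, a)`, given componentwise by composition in `A`. -/
def nerveMap {K : Type w} [EnrichedCategory V K] {A : Type u} [EnrichedCategory V A]
    (S : EnrichedFunctor V K A) (a b : A) :
    (a ⟶[V] b) ⟶ natHom (presheaf S a) (presheaf S b) :=
  natHomLift (presheaf S a) (presheaf S b) (nerveApp S a b) (nerveApp_isVNatural S a b)

/-- Composing a `V`-natural family with a `V`-natural transformation, given by morphisms
`m X : G X ⟶ H X` of `V` compatible with the actions of `C`. -/
lemma IsVNatural.comp_map {C : Type w} [EnrichedCategory V C] {F G H : EnrichedFunctor V C V}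
    {Q : V} {α : ∀ X, Q ⟶ (ihom (F.obj X)).obj (G.obj X)} (hα : IsVNatural F G α)
    (m : ∀ X, G.obj X ⟶ H.obj X)
    (hm : ∀ X Y, m X ▷ (X ⟶[V] Y) ≫ MonoidalClosed.uncurry (H.map X Y) =
      MonoidalClosed.uncurry (G.map X Y) ≫ m Y) :
    IsVNatural F H (fun X => α X ≫ (ihom (F.obj X)).map (m X)) := by
  intro X Y
  apply MonoidalClosed.uncurry_injective
  have h := congrArg MonoidalClosed.uncurry (hα X Y)
  rw [uncurry_tensorHom_comp, MonoidalClosed.uncurry_natural_left, uncurry_tensorHom_comp] at h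
  beta_reduce
  have hu : ∀ Z, MonoidalClosed.uncurry (α Z ≫ (ihom (F.obj Z)).map (m Z)) =
      MonoidalClosed.uncurry (α Z) ≫ m Z := fun Z => MonoidalClosed.uncurry_natural_right _ _
  have hl := uncurry_tensorHom_comp (F.map X Y) (α Y ≫ (ihom (F.obj Y)).map (m Y))
  have hr := uncurry_tensorHom_comp (α X ≫ (ihom (F.obj X)).map (m X)) (H.map X Y)
  rw [hu] at hl hr
  refine hl.trans (Eq.trans ?_ (MonoidalClosed.uncurry_natural_left _ _).symm)
  refine Eq.trans ?_ (congrArg (fun t => _ ◁ _ ≫ t) hr.symm)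
  rw [comp_whiskerRight, Category.assoc, hm X Y]
  simpa only [Category.assoc] using h =≫ m Y

lemma presheafAct_map {K : Type w} [EnrichedCategory V K] {A : Type u} [EnrichedCategory V A]
    {B : Type u₂} [EnrichedCategory V B] (F : EnrichedFunctor V A B)
    (S : EnrichedFunctor V K A) (c : A) (k l : K) :
    F.map (S.obj k) c ▷ _ ≫ presheafAct (S.comp V F) (F.obj c) k l =
      presheafAct S c k l ≫ F.map (S.obj l) c := by
  change F.map (S.obj k) c ▷ _ ≫ (β_ (F.obj (S.obj k) ⟶[V] F.obj c) (l ⟶[V] k)).hom ≫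
    ((S.map l k ≫ F.map _ _) ⊗ₘ 𝟙 _) ≫ eComp V (F.obj (S.obj l)) (F.obj (S.obj k)) (F.obj c) = _
  rw [presheafAct, BraidedCategory.braiding_naturality_left_assoc, Category.assoc,
    Category.assoc, EnrichedFunctor.map_comp, tensorHom_comp_tensorHom_assoc, Category.id_comp,
    ← id_tensorHom, tensorHom_comp_tensorHom_assoc, Category.id_comp, Category.comp_id]

variable (V) in
/-- A weight with domain `Kᵒᵖ`, for a small `V`-category `K`. -/
abbrev Weight (K : Type w) [EnrichedCategory V K] := EnrichedFunctor V Kᵒᵖ V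

variable (V) in
/-- A class of weights: for each small `V`-category `K`, a class of weights with domain `Kᵒᵖ`. -/
def WeightClass := ∀ (K : Type w) [EnrichedCategory V K], Weight V K → Prop

section Colimits

variable {K : Type w} [EnrichedCategory V K] {A : Type u} [EnrichedCategory V A]

/-- A `φ`-weighted cocone on `S` with vertex `c`: a `V`-natural transformation
`φ ⟶ A(S-, c)`, that is, an element of `[Kᵒᵖ, V](φ, A(S-, c))`. -/
abbrev WeightedCocone (φ : Weight V K) (S : EnrichedFunctor V K A) (c : A) :=
  𝟙_ V ⟶ natHom φ (presheaf S c)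

/-- The morphism `A(c, a) ⟶ [Kᵒᵖ, V](φ, A(S-, a))`, `V`-natural in `a`, that corresponds to the
cocone `η : φ ⟶ A(S-, c)` under the Yoneda lemma: the composite
`A(c, a) ≅ 𝟙_ V ⊗ A(c, a) ⟶ [Kᵒᵖ, V](φ, A(S-, c)) ⊗ [Kᵒᵖ, V](A(S-, c), A(S-, a))`
`⟶ [Kᵒᵖ, V](φ, A(S-, a))`. -/
def colimitComparison (φ : Weight V K) (S : EnrichedFunctor V K A) {c : A}
    (η : WeightedCocone φ S c) (a : A) : (c ⟶[V] a) ⟶ natHom φ (presheaf S a) :=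
  (λ_ _).inv ≫ (η ⊗ₘ nerveMap S c a) ≫ natHomComp φ (presheaf S c) (presheaf S a)

/-- `c`, with the cocone `η`, is the weighted colimit `φ * S`: `η` induces isomorphisms
`A(c, a) ≅ [Kᵒᵖ, V](φ, A(S-, a))` for all `a`. -/
def IsWeightedColimit (φ : Weight V K) (S : EnrichedFunctor V K A) {c : A}
    (η : WeightedCocone φ S c) : Prop :=
  ∀ a : A, IsIso (colimitComparison φ S η a)

/-- The image of the cocone `η : φ ⟶ A(S-, c)` under `F : A → B`, namely the composite of `η` with
the `V`-natural transformation `A(S-, c) ⟶ B(F S-, F c)` given by the action of `F` on homs. -/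
def mapCocone {B : Type u₂} [EnrichedCategory V B] (F : EnrichedFunctor V A B) {φ : Weight V K}
    {S : EnrichedFunctor V K A} {c : A} (η : WeightedCocone φ S c) :
    WeightedCocone φ (S.comp V F) (F.obj c) :=
  natHomLift φ (presheaf (S.comp V F) (F.obj c))
    (fun k => (η ≫ natHomπ φ (presheaf S c) k) ≫
      (ihom (φ.obj k)).map (F.map (S.obj k.unop) c))
    (IsVNatural.comp_map (H := presheaf (S.comp V F) (F.obj c))
      (IsVNatural.comp_left (natHomπ_isVNatural φ (presheaf S c)) η)
      (fun k => F.map (S.obj k.unop) c)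
      (fun k l => (congrArg (fun t => F.map (S.obj k.unop) c ▷ _ ≫ t)
        (uncurry_presheaf_map (S.comp V F) (F.obj c) k l)).trans
          ((presheafAct_map F S c k.unop l.unop).trans
            (congrArg (fun t => t ≫ F.map (S.obj l.unop) c)
              (uncurry_presheaf_map S c k l).symm))))

/-- `F : A → B` preserves every colimit `φ * S` that exists in `A`. -/
def PreservesWeightedColimit (φ : Weight V K) (S : EnrichedFunctor V K A)
    {B : Type u₂} [EnrichedCategory V B] (F : EnrichedFunctor V A B) : Prop :=
  ∀ (c : A) (η : WeightedCocone φ S c), IsWeightedColimit φ S η →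
    IsWeightedColimit φ (S.comp V F) (mapCocone F η)

end Colimits

/-- `F : A → B` preserves all `Φ`-colimits (that is, all those that exist in `A`). -/
def PreservesColimits (Φ : WeightClass V) {A : Type u} [EnrichedCategory V A]
    {B : Type u₂} [EnrichedCategory V B] (F : EnrichedFunctor V A B) : Prop :=
  ∀ (L : Type w) [EnrichedCategory V L] (φ : Weight V L), Φ L φ →
    ∀ T : EnrichedFunctor V L A, PreservesWeightedColimit φ T F

/-- `a` is a `Φ`-atom of `A`: the representable `A(a, -)` preserves all `Φ`-colimits. The full
subcategory `A_Φ` of `A` is the one with these objects. -/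
def IsAtom (Φ : WeightClass V) {A : Type u} [EnrichedCategory V A] (a : A) : Prop :=
  PreservesColimits Φ (representable a)

/-- The full subcategory of `A` on the objects satisfying `P` is closed in `A` under those
`Φ`-colimits that exist in `A`. -/
def IsClosedUnderColimits (Φ : WeightClass V) {A : Type u} [EnrichedCategory V A]
    (P : A → Prop) : Prop :=
  ∀ (K : Type w) [EnrichedCategory V K] (φ : Weight V K), Φ K φ →
    ∀ S : EnrichedFunctor V K A, (∀ k, P (S.obj k)) →
      ∀ (c : A) (η : WeightedCocone φ S c), IsWeightedColimit φ S η → P c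

/-- The `V`-functor `{ψ, -} : [Kᵒᵖ, V] → V` sending `T` to its `ψ`-weighted limit
`{ψ, T} = [Kᵒᵖ, V](ψ, T)`. -/
def weightedLimitFunctor {K : Type w} [EnrichedCategory V K] (ψ : Weight V K) :
    EnrichedFunctor V (EnrichedFunctor V Kᵒᵖ V) V :=
  representable ψ

/-- `φ`-colimits commute with `ψ`-limits in `V`: the functor `{ψ, -} : [Kᵒᵖ, V] → V` preserves
`φ`-colimits. -/
def ColimitsCommuteWithLimits {L : Type w} [EnrichedCategory V L] (φ : Weight V L)
    {K : Type w} [EnrichedCategory V K] (ψ : Weight V K) : Prop :=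
  ∀ G : EnrichedFunctor V L (EnrichedFunctor V Kᵒᵖ V),
    PreservesWeightedColimit φ G (weightedLimitFunctor ψ)

/-- The class `Φ⁻` of all weights `ψ` such that `Φ`-colimits commute with `ψ`-limits in `V`. -/
def WeightClass.minus (Φ : WeightClass V) : WeightClass V := fun _ _ ψ =>
  ∀ (L : Type w) [EnrichedCategory V L] (φ : Weight V L), Φ L φ → ColimitsCommuteWithLimits φ ψ

end Weighted

end

end VCat

/-! The defining isomorphisms of the colimit `c` of `S` weighted by `ψ` say that `A(c, -)` is
isomorphic to the composite of the nerve `N : A → [Kᵒᵖ, V]`, `a ↦ A(S-, a)`, with the limit functor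
`{ψ, -} : [Kᵒᵖ, V] → V`. Both factors preserve the relevant colimits. The second does so because `ψ`
lies in `Φ⁻`. For the first, colimits in `[Kᵒᵖ, V]` may be tested pointwise, and at `k` the nerve is
`A(S k, -)`, which preserves `Φ`-colimits since `S k` is an atom. Hence `A(c, -)` preserves every
`Φ`-colimit that exists in `A`.

Three lemmas carry this. `isWeightedColimit_mapCocone_nerve` is the pointwise argument.
`colimitComparison_natural` shows that the isomorphisms `A(c, a) ≅ {ψ, N a}` are natural in `a`.
`isWeightedColimit_of_iso` moves a colimit in `V` along an isomorphism of diagrams and cocones. All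
of them rest on `isWeightedColimit_iff`, which replaces the isomorphism of hom-objects by unique
factorization of families with an arbitrary parameter object `Q`. -/

namespace VCat

noncomputable section

section WeightedColimits

variable {V : Type v} [Category.{w} V] [MonoidalCategory V] [SymmetricCategory V]
  [MonoidalClosed V] [HasLimits V]

/-! ### Weighted colimits through generalized elements -/

section Cocones

variable {K : Type w} [EnrichedCategory V K] {A : Type u} [EnrichedCategory V A]

/-- The components `φ k ⟶ A(S k, c)` of a cocone. -/
def coconeApp {φ : Weight V K} {S : EnrichedFunctor V K A} {c : A} (η : WeightedCocone φ S c)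
    (k : Kᵒᵖ) : φ.obj k ⟶ (S.obj k.unop ⟶[V] c) :=
  (ρ_ _).inv ≫ MonoidalClosed.uncurry (η ≫ natHomπ φ (presheaf S c) k)

/-- A family `φ k ⊗ Q ⟶ A(S k, a)` is compatible if its transpose is `V`-natural in `k`. -/
def IsCompatible (φ : Weight V K) (S : EnrichedFunctor V K A) (a : A) {Q : V}
    (α : ∀ k : Kᵒᵖ, φ.obj k ⊗ Q ⟶ (S.obj k.unop ⟶[V] a)) : Prop :=
  ∀ k l : Kᵒᵖ, (α_ _ _ _).inv ≫ MonoidalClosed.uncurry (φ.map k l) ▷ Q ≫ α l =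
    φ.obj k ◁ (β_ _ _).hom ≫ (α_ _ _ _).inv ≫ α k ▷ _ ≫ presheafAct S a k.unop l.unop

/-- Transposition is injective and carries each side of the naturality square to the corresponding
side of the compatibility equation. The internal homs `[φ k, A(S k, a)]` disappear, leaving
equations between morphisms into homs of `A`. -/
lemma isVNatural_iff_isCompatible (φ : Weight V K) (S : EnrichedFunctor V K A) (a : A) {Q : V}
    (α : ∀ k : Kᵒᵖ, Q ⟶ (ihom (φ.obj k)).obj ((presheaf S a).obj k)) :
    IsVNatural φ (presheaf S a) α ↔
      IsCompatible φ S a (fun k => MonoidalClosed.uncurry (α k)) := by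
  have h1 : ∀ k l, MonoidalClosed.uncurry ((φ.map k l ⊗ₘ α l) ≫ eComp V _ _ _) =
      (α_ _ _ _).inv ≫ MonoidalClosed.uncurry (φ.map k l) ▷ Q ≫ MonoidalClosed.uncurry (α l) :=
    fun k l => uncurry_tensorHom_comp _ _
  have h2 : ∀ k l, MonoidalClosed.uncurry
      ((β_ _ _).hom ≫ (α k ⊗ₘ (presheaf S a).map k l) ≫
        eComp V (φ.obj k) ((presheaf S a).obj k) ((presheaf S a).obj l)) =
      φ.obj k ◁ (β_ _ _).hom ≫ (α_ _ _ _).inv ≫ MonoidalClosed.uncurry (α k) ▷ _ ≫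
        presheafAct S a k.unop l.unop := fun k l =>
    (MonoidalClosed.uncurry_natural_left _ _).trans
      (congrArg (fun t => φ.obj k ◁ (β_ _ _).hom ≫ t)
        ((uncurry_tensorHom_comp (α k) ((presheaf S a).map k l)).trans
          (congrArg (fun t => (α_ _ _ _).inv ≫ MonoidalClosed.uncurry (α k) ▷ _ ≫ t)
            (uncurry_presheaf_map S a k l))))
  constructor
  · intro h k l
    exact (h1 k l).symm.trans ((congrArg MonoidalClosed.uncurry (h k l)).trans (h2 k l))
  · intro h k l
    apply MonoidalClosed.uncurry_injective
    exact (h1 k l).trans ((h k l).trans (h2 k l).symm)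

lemma nerveMap_π (S : EnrichedFunctor V K A) (a b : A) (k : Kᵒᵖ) :
    nerveMap S a b ≫ natHomπ (presheaf S a) (presheaf S b) k = nerveApp S a b k :=
  natHomLift_π _ _ _ _ _

lemma natHomComp_π {C : Type w} [EnrichedCategory V C] {D : Type u} [EnrichedCategory V D]
    (F G H : EnrichedFunctor V C D) (X : C) :
    natHomComp F G H ≫ natHomπ F H X = (natHomπ F G X ⊗ₘ natHomπ G H X) ≫ eComp V _ _ _ :=
  natHomLift_π _ _ _ _ _

lemma uncurry_nerveApp (S : EnrichedFunctor V K A) (a b : A) (k : Kᵒᵖ) :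
    MonoidalClosed.uncurry (nerveApp S a b k) = eComp V (S.obj k.unop) a b :=
  MonoidalClosed.uncurry_curry _

lemma colimitComparison_π {φ : Weight V K} {S : EnrichedFunctor V K A} {c : A}
    (η : WeightedCocone φ S c) (a : A) (k : Kᵒᵖ) :
    colimitComparison φ S η a ≫ natHomπ φ (presheaf S a) k =
      (λ_ _).inv ≫ ((η ≫ natHomπ φ (presheaf S c) k) ⊗ₘ nerveApp S c a k) ≫
        eComp V _ _ _ := by
  rw [colimitComparison, Category.assoc, Category.assoc, natHomComp_π,
    tensorHom_comp_tensorHom_assoc, nerveMap_π]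

/-- After transposition the comparison is composition with the legs of the cocone, so "`f` is sent
to `α`" becomes "`α` factors through the legs by `f`". -/
lemma uncurry_colimitComparison {φ : Weight V K} {S : EnrichedFunctor V K A} {c : A}
    (η : WeightedCocone φ S c) {a : A} {Q : V} (f : Q ⟶ (c ⟶[V] a)) (k : Kᵒᵖ) :
    MonoidalClosed.uncurry (f ≫ colimitComparison φ S η a ≫ natHomπ φ (presheaf S a) k) =
      (coconeApp η k ⊗ₘ f) ≫ eComp V (S.obj k.unop) c a := by
  obtain ⟨e, he⟩ : ∃ e : φ.obj k ⊗ 𝟙_ V ⟶ (S.obj k.unop ⟶[V] c),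
      e = MonoidalClosed.uncurry (η ≫ natHomπ φ (presheaf S c) k) := ⟨_, rfl⟩
  have h : MonoidalClosed.uncurry (((η ≫ natHomπ φ (presheaf S c) k) ⊗ₘ nerveApp S c a k) ≫
        eComp V _ _ _) = (α_ _ _ _).inv ≫ e ▷ _ ≫ eComp V (S.obj k.unop) c a := by
    rw [he]
    exact (uncurry_tensorHom_comp _ _).trans
      (congrArg (fun t => (α_ _ _ _).inv ≫
          MonoidalClosed.uncurry (η ≫ natHomπ φ (presheaf S c) k) ▷ _ ≫ t)
        (uncurry_nerveApp S c a k))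
  have h' : coconeApp η k = (ρ_ _).inv ≫ e := by rw [he]; rfl
  rw [colimitComparison_π, MonoidalClosed.uncurry_natural_left,
    MonoidalClosed.uncurry_natural_left, h, h', MonoidalCategory.tensorHom_def',
    comp_whiskerRight, Category.assoc, Category.assoc, ← triangle_assoc_comp_left_inv_assoc]
  rfl

/-- The universal property of a weighted colimit, in terms of generalized elements. -/
lemma isWeightedColimit_iff {φ : Weight V K} {S : EnrichedFunctor V K A} {c : A}
    (η : WeightedCocone φ S c) :
    IsWeightedColimit φ S η ↔ ∀ (a : A) (Q : V)
      (α : ∀ k : Kᵒᵖ, φ.obj k ⊗ Q ⟶ (S.obj k.unop ⟶[V] a)), IsCompatible φ S a α →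
        ∃! f : Q ⟶ (c ⟶[V] a), ∀ k, (coconeApp η k ⊗ₘ f) ≫ eComp V (S.obj k.unop) c a = α k := by
  constructor
  · intro h a Q α hα
    have := h a
    have hn : IsVNatural φ (presheaf S a) (fun k => MonoidalClosed.curry (α k)) := by
      have h' : (fun k => MonoidalClosed.uncurry (MonoidalClosed.curry (α k))) = α :=
        funext fun k => MonoidalClosed.uncurry_curry _
      rw [← h'] at hα
      exact (isVNatural_iff_isCompatible φ S a _).2 hα
    refine ⟨natHomLift _ _ _ hn ≫ inv (colimitComparison φ S η a), fun k => ?_, fun f hf => ?_⟩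
    · rw [← uncurry_colimitComparison, Category.assoc, IsIso.inv_hom_id_assoc, natHomLift_π]
      exact MonoidalClosed.uncurry_curry _
    · rw [IsIso.eq_comp_inv]
      apply natHom_ext
      intro k
      rw [natHomLift_π, Category.assoc]
      apply MonoidalClosed.uncurry_injective
      rw [uncurry_colimitComparison, hf]
      exact (MonoidalClosed.uncurry_curry _).symm
  · intro h a
    -- Bijectivity of the comparison on `Q`-elements for every `Q`; as in the Yoneda lemma, this
    -- makes it invertible.
    have key : ∀ {Q : V} (g : Q ⟶ natHom φ (presheaf S a)),
        ∃! f : Q ⟶ (c ⟶[V] a), f ≫ colimitComparison φ S η a = g := by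
      intro Q g
      have hg := (isVNatural_iff_isCompatible φ S a _).1
        ((natHomπ_isVNatural φ (presheaf S a)).comp_left g)
      have hiff : ∀ f : Q ⟶ (c ⟶[V] a), f ≫ colimitComparison φ S η a = g ↔
          ∀ k, (coconeApp η k ⊗ₘ f) ≫ eComp V (S.obj k.unop) c a =
            MonoidalClosed.uncurry (g ≫ natHomπ φ (presheaf S a) k) := by
        intro f
        constructor
        · rintro rfl k
          rw [← uncurry_colimitComparison, Category.assoc]
        · intro hf
          apply natHom_ext
          intro k
          apply MonoidalClosed.uncurry_injective
          rw [← hf k, ← uncurry_colimitComparison, Category.assoc]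
      obtain ⟨f, hf, hu⟩ := h a Q _ hg
      exact ⟨f, (hiff f).2 hf, fun f' hf' => hu f' ((hiff f').1 hf')⟩
    -- The preimage of the identity is a right-hand candidate for the inverse; uniqueness of
    -- preimages of the comparison itself gives the other identity.
    obtain ⟨i, hi, -⟩ := key (𝟙 _)
    refine ⟨i, (key (colimitComparison φ S η a)).unique ?_ (Category.id_comp _), hi⟩
    rw [Category.assoc, hi, Category.comp_id]

/-- The components of the image of a cocone under a `V`-functor. -/
lemma coconeApp_mapCocone {B : Type u₂} [EnrichedCategory V B] (F : EnrichedFunctor V A B)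
    {φ : Weight V K} {S : EnrichedFunctor V K A} {c : A} (η : WeightedCocone φ S c) (k : Kᵒᵖ) :
    coconeApp (mapCocone F η) k = coconeApp η k ≫ F.map (S.obj k.unop) c := by
  have h : mapCocone F η ≫ natHomπ φ (presheaf (S.comp V F) (F.obj c)) k =
      (η ≫ natHomπ φ (presheaf S c) k) ≫ (ihom (φ.obj k)).map (F.map (S.obj k.unop) c) :=
    natHomLift_π _ _ _ _ _
  rw [coconeApp, coconeApp, Category.assoc]
  exact congrArg (fun t => (ρ_ _).inv ≫ t)
    ((congrArg MonoidalClosed.uncurry h).trans (MonoidalClosed.uncurry_natural_right _ _))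

end Cocones

/-! ### Composition in `V` with an actual morphism among the factors -/

section Internal

/-- This and `tensorHom_map_comp` are associativity of composition when one of three composable
arrows is a genuine morphism `s` of `V`, placed first here and in the middle there. -/
lemma tensorHom_pre_comp {x x' y z P Q : V} (s : x ⟶ x') (f : P ⟶ (ihom x').obj y)
    (g : Q ⟶ (ihom y).obj z) :
    ((f ≫ (MonoidalClosed.pre s).app y) ⊗ₘ g) ≫ eComp V x y z =
      ((f ⊗ₘ g) ≫ eComp V x' y z) ≫ (MonoidalClosed.pre s).app z := by
  apply MonoidalClosed.uncurry_injective
  refine (uncurry_tensorHom_comp _ _).trans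
    (Eq.trans ?_ (MonoidalClosed.uncurry_pre_app _ ((f ⊗ₘ g) ≫ eComp V x' y z) s).symm)
  rw [MonoidalClosed.uncurry_pre_app, uncurry_tensorHom_comp, comp_whiskerRight, Category.assoc,
    ← associator_inv_naturality_left_assoc]

lemma tensorHom_map_comp {x y y' z P Q : V} (s : y ⟶ y') (f : P ⟶ (ihom x).obj y)
    (g : Q ⟶ (ihom y').obj z) :
    ((f ≫ (ihom x).map s) ⊗ₘ g) ≫ eComp V x y' z =
      (f ⊗ₘ (g ≫ (MonoidalClosed.pre s).app z)) ≫ eComp V x y z := by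
  apply MonoidalClosed.uncurry_injective
  rw [uncurry_tensorHom_comp, uncurry_tensorHom_comp, MonoidalClosed.uncurry_pre_app,
    MonoidalClosed.uncurry_natural_right, comp_whiskerRight, Category.assoc]

lemma pre_app_comp_inv {x y : V} (s : x ≅ y) (z : V) :
    (MonoidalClosed.pre s.hom).app z ≫ (MonoidalClosed.pre s.inv).app z = 𝟙 _ := by
  rw [← NatTrans.comp_app, ← MonoidalClosed.pre_map, s.inv_hom_id, MonoidalClosed.pre_id,
    NatTrans.id_app]

lemma leftUnitor_inv_comp_tensorHom {X Y P Q : V} (f : 𝟙_ V ⊗ X ⟶ P) (g : Y ⟶ Q) :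
    (((λ_ X).inv ≫ f) ⊗ₘ g) = (λ_ (X ⊗ Y)).inv ≫ (α_ _ _ _).inv ≫ (f ⊗ₘ g) := by
  rw [← Category.id_comp g, ← tensorHom_comp_tensorHom, tensorHom_id,
    leftUnitor_inv_whiskerRight, Category.assoc, Category.id_comp]

end Internal

/-- Naturality of `n` and of the composite of `n` with `f` gives, by associativity, the naturality
square of `f` precomposed with `n X`. When the `n X` come from a colimit cocone they can jointly be
cancelled, so `f` itself is natural. -/
lemma IsVNatural.cancel_left {C : Type w} [EnrichedCategory V C] {D : Type u}
    [EnrichedCategory V D] {F G H : EnrichedFunctor V C D} {Q R : V}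
    {n : ∀ X, Q ⟶ (F.obj X ⟶[V] G.obj X)} (hn : IsVNatural F G n)
    (f : ∀ X, R ⟶ (G.obj X ⟶[V] H.obj X))
    (hnf : IsVNatural F H (fun X => (n X ⊗ₘ f X) ≫ eComp V _ _ _)) (X Y : C) :
    (n X ⊗ₘ ((G.map X Y ⊗ₘ f Y) ≫ eComp V _ _ _)) ≫ eComp V _ _ _ =
      (n X ⊗ₘ ((β_ _ _).hom ≫ (f X ⊗ₘ H.map X Y) ≫ eComp V _ _ _)) ≫ eComp V _ _ _ := by
  have h0 : (n X ⊗ₘ G.map X Y) ≫ eComp V _ _ _ =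
      (β_ _ _).inv ≫ (F.map X Y ⊗ₘ n Y) ≫ eComp V _ _ _ := by
    rw [Iso.eq_inv_comp, hn X Y]
  have h1 : ∀ {P P' : V} (a : P ⟶ P') (b : P' ⟶ (F.obj X ⟶[V] G.obj Y)),
      ((a ≫ b) ⊗ₘ f Y) = a ▷ _ ≫ (b ⊗ₘ f Y) := by
    intros
    rw [← tensorHom_id, tensorHom_comp_tensorHom, Category.id_comp]
  have h2 : ∀ {P P' : V} (a : P ⟶ P') (b : P' ⟶ (G.obj X ⟶[V] H.obj Y)),
      (n X ⊗ₘ (a ≫ b)) = _ ◁ a ≫ (n X ⊗ₘ b) := by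
    intros
    rw [← id_tensorHom, tensorHom_comp_tensorHom, Category.id_comp]
  have h3 : (((F.map X Y ⊗ₘ n Y) ≫ eComp V _ _ _) ⊗ₘ f Y) ≫ eComp V _ _ _ =
      (α_ _ _ _).hom ≫ (F.map X Y ⊗ₘ ((n Y ⊗ₘ f Y) ≫ eComp V _ _ _)) ≫ eComp V _ _ _ := by
    rw [tensorHom_comp_assoc, Iso.hom_inv_id_assoc]
  have h4 : (((n X ⊗ₘ f X) ≫ eComp V _ _ _) ⊗ₘ H.map X Y) ≫ eComp V _ _ _ =
      (α_ _ _ _).hom ≫ (n X ⊗ₘ ((f X ⊗ₘ H.map X Y) ≫ eComp V _ _ _)) ≫ eComp V _ _ _ := by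
    rw [tensorHom_comp_assoc, Iso.hom_inv_id_assoc]
  rw [tensorHom_comp_assoc, h0, h1, Category.assoc, h3, hnf X Y, h2, h4,
    BraidedCategory.braiding_tensor_right_hom]
  simp only [Category.assoc, Iso.inv_hom_id_assoc, Iso.hom_inv_id_assoc,
    inv_hom_whiskerRight_assoc]

/-! ### The nerve of `S` and naturality of the comparison -/

section Nerve

variable {K : Type w} [EnrichedCategory V K] {A : Type u} [EnrichedCategory V A]

/-- The `V`-functor `A → [Kᵒᵖ, V]` sending `a` to `A(S-, a)`. -/
def nerve (S : EnrichedFunctor V K A) : EnrichedFunctor V A (EnrichedFunctor V Kᵒᵖ V) where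
  obj := presheaf S
  map := nerveMap S
  -- Components detect equality in `[Kᵒᵖ, V]`, and at `k` both functor laws are those of the
  -- representable `A(S k, -)`.
  map_id a := by
    apply natHom_ext
    intro k
    rw [Category.assoc, nerveMap_π]
    exact ((representable (S.obj k.unop)).map_id a).trans
      (natHomLift_π (presheaf S a) (presheaf S a) (fun k => eId V ((presheaf S a).obj k))
        (isVNatural_id _) k).symm
  map_comp a b c := by
    apply natHom_ext
    intro k
    rw [Category.assoc, nerveMap_π, Category.assoc]
    refine ((representable (S.obj k.unop)).map_comp a b c).trans ?_
    refine Eq.trans ?_ (congrArg (fun t => (nerveMap S a b ⊗ₘ nerveMap S b c) ≫ t)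
      (natHomComp_π (presheaf S a) (presheaf S b) (presheaf S c) k)).symm
    rw [tensorHom_comp_tensorHom_assoc, nerveMap_π, nerveMap_π]
    rfl

/-- The comparison `A(c, a) ⟶ {φ, A(S-, a)}` is `V`-natural in `a`. -/
lemma colimitComparison_natural {φ : Weight V K} {S : EnrichedFunctor V K A} {c : A}
    (η : WeightedCocone φ S c) (a b : A) :
    (representable c).map a b ≫ (ihom (c ⟶[V] a)).map (colimitComparison φ S η b) =
      ((nerve S).map a b ≫ (weightedLimitFunctor φ).map (presheaf S a) (presheaf S b)) ≫
        (MonoidalClosed.pre (colimitComparison φ S η a)).app (natHom φ (presheaf S b)) := by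
  apply MonoidalClosed.uncurry_injective
  have hl : MonoidalClosed.uncurry ((representable c).map a b) = eComp V c a b :=
    MonoidalClosed.uncurry_curry _
  have hr : MonoidalClosed.uncurry ((nerve S).map a b ≫
      (weightedLimitFunctor φ).map (presheaf S a) (presheaf S b)) =
      _ ◁ nerveMap S a b ≫ natHomComp φ (presheaf S a) (presheaf S b) :=
    (MonoidalClosed.uncurry_natural_left _ _).trans
      (congrArg (fun t => _ ◁ nerveMap S a b ≫ t) (MonoidalClosed.uncurry_curry _))
  have hc : eComp V c a b ≫ nerveMap S c b = (nerveMap S c a ⊗ₘ nerveMap S a b) ≫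
      natHomComp (presheaf S c) (presheaf S a) (presheaf S b) := (nerve S).map_comp c a b
  have ha := tensorHom_comp_assoc (V := V) (D := EnrichedFunctor V Kᵒᵖ V) η (nerveMap S c a)
    (nerveMap S a b)
  change (_ ⊗ₘ (_ ≫ natHomComp (presheaf S c) (presheaf S a) (presheaf S b))) ≫
    natHomComp φ (presheaf S c) (presheaf S b) = _ ≫
    ((_ ≫ natHomComp φ (presheaf S c) (presheaf S a)) ⊗ₘ _) ≫
      natHomComp φ (presheaf S a) (presheaf S b) at ha
  -- The naturality square in transposed form: functoriality of the nerve (`hc`) followed by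
  -- associativity in `[Kᵒᵖ, V]` (`ha`), with `η` as first factor.
  have h : eComp V c a b ≫ colimitComparison φ S η b = colimitComparison φ S η a ▷ (a ⟶[V] b) ≫
      natHom φ (presheaf S a) ◁ nerveMap S a b ≫ natHomComp φ (presheaf S a) (presheaf S b) := by
    rw [← MonoidalCategory.tensorHom_def_assoc, colimitComparison, leftUnitor_inv_naturality_assoc,
      ← id_tensorHom, tensorHom_comp_tensorHom_assoc, Category.id_comp, hc, ha, colimitComparison,
      leftUnitor_inv_comp_tensorHom, Category.assoc, Category.assoc]
  exact (MonoidalClosed.uncurry_natural_right _ _).trans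
    ((congrArg (fun t => t ≫ colimitComparison φ S η b) hl).trans
      (h.trans ((congrArg (fun t => colimitComparison φ S η a ▷ (a ⟶[V] b) ≫ t) hr).symm.trans
        (MonoidalClosed.uncurry_pre_app _ _ _).symm)))

end Nerve

/-! ### Transport of colimits in `V` along isomorphisms -/

section Transfer

variable {L : Type w} [EnrichedCategory V L]

/-- The hypothesis `hσ` is naturality of `σ`, written inside the internal hom. Its inverse is then
natural too, and precomposition with that inverse is a map of presheaves from `V(S-, a)` to `V(S'-,
a)`. -/
lemma pre_whiskerRight_presheafAct {S S' : EnrichedFunctor V L V} (σ : ∀ l, S.obj l ≅ S'.obj l)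
    (hσ : ∀ l m, S.map l m ≫ (ihom (S.obj l)).map (σ m).hom =
      S'.map l m ≫ (MonoidalClosed.pre (σ l).hom).app (S'.obj m)) (a : V) (k l : L) :
    (MonoidalClosed.pre (σ k).inv).app a ▷ (l ⟶[V] k) ≫ presheafAct S' a k l =
      presheafAct S a k l ≫ (MonoidalClosed.pre (σ l).inv).app a := by
  have h : S'.map l k ≫ (ihom (S'.obj l)).map (σ k).inv =
      S.map l k ≫ (MonoidalClosed.pre (σ l).inv).app (S.obj k) := by
    rw [← cancel_mono ((ihom (S'.obj l)).map (σ k).hom), Category.assoc, Category.assoc,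
      MonoidalClosed.pre_comm_ihom_map, reassoc_of% (hσ l k), pre_app_comp_inv,
      ← CategoryTheory.Functor.map_comp, Iso.inv_hom_id,
      CategoryTheory.Functor.map_id]
  have h' : (S'.map l k ⊗ₘ (𝟙 ((ihom (S.obj k)).obj a) ≫ (MonoidalClosed.pre (σ k).inv).app a)) ≫
      eComp V (S'.obj l) (S'.obj k) a =
      ((S.map l k ⊗ₘ 𝟙 ((ihom (S.obj k)).obj a)) ≫ eComp V (S.obj l) (S.obj k) a) ≫
        (MonoidalClosed.pre (σ l).inv).app a :=
    (tensorHom_map_comp (σ k).inv (S'.map l k) (𝟙 _)).symm.trans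
      ((congrArg (fun t => (t ⊗ₘ 𝟙 ((ihom (S.obj k)).obj a)) ≫
        eComp V (S'.obj l) (S.obj k) a) h).trans
        (tensorHom_pre_comp (σ l).inv (S.map l k) (𝟙 _)))
  rw [Category.id_comp] at h'
  have h'' : (MonoidalClosed.pre (σ k).inv).app a ▷ (l ⟶[V] k) ≫ (β_ _ _).hom ≫
      (S'.map l k ⊗ₘ 𝟙 ((ihom (S'.obj k)).obj a)) =
      (β_ _ _).hom ≫ (S'.map l k ⊗ₘ (MonoidalClosed.pre (σ k).inv).app a) := by
    rw [BraidedCategory.braiding_naturality_left_assoc, ← id_tensorHom,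
      tensorHom_comp_tensorHom, Category.id_comp, Category.comp_id]
  rw [presheafAct, presheafAct]
  refine Eq.trans ?_ ((congrArg (fun t => (β_ _ _).hom ≫ t) h').trans ?_)
  · refine Eq.trans ?_ ((congrArg (fun t => t ≫ eComp V (S'.obj l) (S'.obj k) a) h'').trans
      (Category.assoc _ _ _))
    simp only [Category.assoc]
    rfl
  · simp only [Category.assoc]
    rfl

/-- Weighted colimits in `V` are invariant under isomorphisms of diagrams and cocones. -/
lemma isWeightedColimit_of_iso {φ : Weight V L} {S S' : EnrichedFunctor V L V} {c c' : V}
    {η : WeightedCocone φ S c} {η' : WeightedCocone φ S' c'} (σ : ∀ l, S.obj l ≅ S'.obj l)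
    (τ : c ≅ c')
    (hσ : ∀ l m, S.map l m ≫ (ihom (S.obj l)).map (σ m).hom =
      S'.map l m ≫ (MonoidalClosed.pre (σ l).hom).app (S'.obj m))
    (hη : ∀ l : Lᵒᵖ, coconeApp η l ≫ (ihom (S.obj l.unop)).map τ.hom =
      coconeApp η' l ≫ (MonoidalClosed.pre (σ l.unop).hom).app c')
    (h : IsWeightedColimit φ S' η') : IsWeightedColimit φ S η := by
  rw [isWeightedColimit_iff] at h ⊢
  intro a Q α hα
  -- A test family on `S` becomes one on `S'` by precomposing with the inverse of `σ`.
  have hcompat : IsCompatible φ S' a (Q := Q)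
      (fun k => α k ≫ (MonoidalClosed.pre (σ k.unop).inv).app a) := by
    intro k l
    have := hα k l =≫ (MonoidalClosed.pre (σ l.unop).inv).app a
    simp only [Category.assoc] at this
    refine this.trans ?_
    refine congrArg (fun t => φ.obj k ◁ (β_ _ _).hom ≫ (α_ _ _ _).inv ≫ t) ?_
    refine (congrArg (fun t => α k ▷ (k ⟶[V] l) ≫ t)
      (pre_whiskerRight_presheafAct σ hσ a k.unop l.unop)).symm.trans ?_
    refine Eq.trans (Category.assoc _ _ _).symm ?_
    exact congrArg (fun t => t ≫ presheafAct S' a k.unop l.unop)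
      (comp_whiskerRight _ _ _).symm
  have hom_inv : ∀ f : Q ⟶ (ihom c').obj a,
      (f ≫ (MonoidalClosed.pre τ.hom).app a) ≫ (MonoidalClosed.pre τ.inv).app a = f := fun f => by
    rw [Category.assoc, pre_app_comp_inv, Category.comp_id]
  have inv_hom : ∀ f : Q ⟶ (ihom c).obj a,
      (f ≫ (MonoidalClosed.pre τ.inv).app a) ≫ (MonoidalClosed.pre τ.hom).app a = f := fun f => by
    have := pre_app_comp_inv τ.symm a
    rw [Iso.symm_hom, Iso.symm_inv] at this
    rw [Category.assoc, this, Category.comp_id]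
  -- Factorizations `f` through `η` correspond to factorizations through `η'` by precomposing with
  -- the inverse of `τ`; existence and uniqueness then both transfer.
  have key : ∀ (f : Q ⟶ (ihom c).obj a) (k : Lᵒᵖ),
      (coconeApp η k ⊗ₘ f) ≫ eComp V (S.obj k.unop) c a = α k ↔
        (coconeApp η' k ⊗ₘ (f ≫ (MonoidalClosed.pre τ.inv).app a)) ≫
          eComp V (S'.obj k.unop) c' a = α k ≫ (MonoidalClosed.pre (σ k.unop).inv).app a := by
    intro f k
    have h1 : (coconeApp η' k ≫ (MonoidalClosed.pre (σ k.unop).hom).app c') ≫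
        (MonoidalClosed.pre (σ k.unop).inv).app c' = coconeApp η' k :=
      (Category.assoc _ _ _).trans ((congrArg (fun t => coconeApp η' k ≫ t)
        (pre_app_comp_inv (σ k.unop) c')).trans (Category.comp_id _))
    have h3 : (coconeApp η' k ⊗ₘ (f ≫ (MonoidalClosed.pre τ.inv).app a)) ≫
        eComp V (S'.obj k.unop) c' a = ((coconeApp η k ⊗ₘ f) ≫ eComp V (S.obj k.unop) c a) ≫
          (MonoidalClosed.pre (σ k.unop).inv).app a := by
      have h4 := tensorHom_map_comp τ.hom (coconeApp η k) (f ≫ (MonoidalClosed.pre τ.inv).app a)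
      rw [inv_hom] at h4
      have h5 := tensorHom_pre_comp (σ k.unop).inv
        (coconeApp η' k ≫ (MonoidalClosed.pre (σ k.unop).hom).app c')
        (f ≫ (MonoidalClosed.pre τ.inv).app a)
      rw [← hη] at h5 h1
      rw [← h1]
      exact h5.trans (congrArg (fun t => t ≫ (MonoidalClosed.pre (σ k.unop).inv).app a) h4)
    have : IsIso ((MonoidalClosed.pre (σ k.unop).inv).app a) :=
      ⟨_, pre_app_comp_inv (σ k.unop).symm a, pre_app_comp_inv (σ k.unop) a⟩
    rw [h3]
    exact (cancel_mono ((MonoidalClosed.pre (σ k.unop).inv).app a)).symm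
  obtain ⟨f, hf, hu⟩ := h a Q _ hcompat
  refine ⟨f ≫ (MonoidalClosed.pre τ.hom).app a, fun k => (key _ k).2 ?_, fun g hg => ?_⟩
  · rw [hom_inv]
    exact hf k
  · rw [← hu (g ≫ (MonoidalClosed.pre τ.inv).app a) fun k => (key g k).1 (hg k)]
    exact (inv_hom g).symm

end Transfer

/-! ### Pointwise colimits in the presheaf category -/

section Pointwise

variable {L : Type w} [EnrichedCategory V L] {K : Type w} [EnrichedCategory V K]
  {A : Type u} [EnrichedCategory V A]

/-- The legs of a colimit cocone are jointly epic in the enriched sense, because the comparison is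
invertible and hence mono. -/
lemma IsWeightedColimit.hom_ext {φ : Weight V K} {S : EnrichedFunctor V K A} {c : A}
    {η : WeightedCocone φ S c} (h : IsWeightedColimit φ S η) {a : A} {Q : V}
    {f g : Q ⟶ (c ⟶[V] a)} (hfg : ∀ k, (coconeApp η k ⊗ₘ f) ≫ eComp V (S.obj k.unop) c a =
      (coconeApp η k ⊗ₘ g) ≫ eComp V (S.obj k.unop) c a) : f = g := by
  have := h a
  rw [← cancel_mono (colimitComparison φ S η a)]
  apply natHom_ext
  intro k
  apply MonoidalClosed.uncurry_injective
  rw [Category.assoc, Category.assoc, uncurry_colimitComparison, uncurry_colimitComparison, hfg]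

/-- Composition in `[Kᵒᵖ, V]` is componentwise, so projecting at `k` turns the action for the nerve
into the action for `A(S k, -)`. Compatible families into `P` thus restrict to compatible families
into `P k`. -/
lemma presheafAct_nerve_π (T : EnrichedFunctor V L A) (S : EnrichedFunctor V K A)
    (P : EnrichedFunctor V Kᵒᵖ V) (l m : L) (k : Kᵒᵖ) :
    presheafAct (T.comp V (nerve S)) P l m ≫ natHomπ (presheaf S (T.obj m)) P k =
      natHomπ (presheaf S (T.obj l)) P k ▷ (m ⟶[V] l) ≫
        presheafAct (T.comp V (representable (S.obj k.unop))) (P.obj k) l m := by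
  have h3 : natHomπ (presheaf S (T.obj l)) P k ▷ (m ⟶[V] l) ≫ (β_ _ _).hom ≫
      ((T.map m l ≫ nerveApp S (T.obj m) (T.obj l) k) ⊗ₘ
        𝟙 (EnrichedCategory.Hom ((presheaf S (T.obj l)).obj k) (P.obj k) : V)) = (β_ _ _).hom ≫
      ((T.map m l ≫ nerveApp S (T.obj m) (T.obj l) k) ⊗ₘ
        natHomπ (presheaf S (T.obj l)) P k) := by
    rw [BraidedCategory.braiding_naturality_left_assoc, ← id_tensorHom,
      tensorHom_comp_tensorHom, Category.id_comp, Category.comp_id]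
  have h : ((β_ _ _).hom ≫ ((T.map m l ≫ nerveMap S (T.obj m) (T.obj l)) ⊗ₘ
        𝟙 (natHom (presheaf S (T.obj l)) P)) ≫
        natHomComp (presheaf S (T.obj m)) (presheaf S (T.obj l)) P) ≫ natHomπ _ _ k =
      natHomπ (presheaf S (T.obj l)) P k ▷ (m ⟶[V] l) ≫ (β_ _ _).hom ≫
        ((T.map m l ≫ nerveApp S (T.obj m) (T.obj l) k) ⊗ₘ
          𝟙 (EnrichedCategory.Hom ((presheaf S (T.obj l)).obj k) (P.obj k) : V)) ≫
          eComp V _ _ _ := by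
    rw [Category.assoc, Category.assoc, natHomComp_π, tensorHom_comp_tensorHom_assoc,
      Category.assoc, nerveMap_π, Category.id_comp, reassoc_of% h3]
  exact h

/-- The nerve `a ↦ A(S-, a)` preserves a colimit that is preserved by each `A(S k, -)`. -/
lemma isWeightedColimit_mapCocone_nerve {φ : Weight V L} {T : EnrichedFunctor V L A} {d : A}
    {θ : WeightedCocone φ T d} (S : EnrichedFunctor V K A)
    (h : ∀ k, IsWeightedColimit φ (T.comp V (representable (S.obj k)))
      (mapCocone (representable (S.obj k)) θ)) :
    IsWeightedColimit φ (T.comp V (nerve S)) (mapCocone (nerve S) θ) := by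
  rw [isWeightedColimit_iff]
  intro P Q α hα
  change ∀ l : Lᵒᵖ, φ.obj l ⊗ Q ⟶ natHom (presheaf S (T.obj l.unop)) P at α
  have hcompat : ∀ k : Kᵒᵖ, IsCompatible φ (T.comp V (representable (S.obj k.unop))) (P.obj k)
      (fun l => α l ≫ natHomπ (presheaf S (T.obj l.unop)) P k) := by
    intro k l m
    refine (by simp only [Category.assoc]; rfl : _ = ((α_ _ _ _).inv ≫
      MonoidalClosed.uncurry (φ.map l m) ▷ Q ≫ α m) ≫ natHomπ _ _ k).trans ?_
    refine (congrArg (fun t => t ≫ natHomπ (presheaf S (T.obj m.unop)) P k) (hα l m)).trans ?_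
    have e : ∀ {X₀ X₁ X₂ X₃ X₄ : V} (p : X₀ ⟶ X₁) (q : X₁ ⟶ X₂) (r : X₂ ⟶ X₃) (s : X₃ ⟶ X₄)
        {X₅ : V} (t : X₄ ⟶ X₅), (p ≫ q ≫ r ≫ s) ≫ t = p ≫ q ≫ r ≫ s ≫ t := by
      intros; simp only [Category.assoc]
    refine (e _ _ _ _ _).trans ?_
    refine congrArg (fun t => φ.obj l ◁ (β_ _ _).hom ≫ (α_ _ _ _).inv ≫ t) ?_
    refine (congrArg (fun t => α l ▷ (l ⟶[V] m) ≫ t)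
      (presheafAct_nerve_π T S P l.unop m.unop k)).trans ?_
    refine Eq.trans (Category.assoc _ _ _).symm ?_
    exact congrArg (fun t => t ≫ presheafAct (T.comp V (representable (S.obj k.unop))) (P.obj k)
      l.unop m.unop) (comp_whiskerRight _ _ _).symm
  -- The colimit at each `k` supplies a unique component; what remains is that these components are
  -- natural in `k`.
  choose f' hf hu using fun k : Kᵒᵖ => (isWeightedColimit_iff _).1 (h k.unop) (P.obj k) Q _
    (hcompat k)
  -- The same morphisms, with `A(S k, d)` now read as the value at `k` of `A(S-, d)` rather than the
  -- value at `d` of `A(S k, -)`.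
  obtain ⟨f, rfl⟩ : ∃ f : ∀ k : Kᵒᵖ,
      Q ⟶ (EnrichedCategory.Hom ((presheaf S d).obj k) (P.obj k) : V), f = f' := ⟨f', rfl⟩
  have happ : ∀ (l : Lᵒᵖ) (k : Kᵒᵖ),
      coconeApp (mapCocone (representable (S.obj k.unop)) θ) l =
        coconeApp θ l ≫ nerveApp S (T.obj l.unop) d k := fun l k => coconeApp_mapCocone _ θ l
  have hf' : ∀ (l : Lᵒᵖ) (k : Kᵒᵖ),
      ((coconeApp θ l ≫ nerveApp S (T.obj l.unop) d k) ⊗ₘ f k) ≫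
        eComp V ((presheaf S (T.obj l.unop)).obj k) ((presheaf S d).obj k) (P.obj k) =
      α l ≫ natHomπ (presheaf S (T.obj l.unop)) P k := fun l k => by
    rw [← happ]
    exact hf k l
  -- Both sides of the square at `X`, `Y` are maps out of the colimit at `X`, so they are compared
  -- on its legs. Composed with the legs, `f` becomes the components of `α l`, which are natural.
  have hnat : IsVNatural (presheaf S d) P f := by
    intro X Y
    refine (h X.unop).hom_ext fun l => ?_
    rw [happ]
    refine IsVNatural.cancel_left (F := presheaf S (T.obj l.unop)) (G := presheaf S d) (H := P)
      ((nerveApp_isVNatural S (T.obj l.unop) d).comp_left (coconeApp θ l)) f ?_ X Y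
    have h' := (natHomπ_isVNatural (presheaf S (T.obj l.unop)) P).comp_left (α l)
    rwa [← funext (hf' l)] at h'
  -- The factorization equation in `[Kᵒᵖ, V]` has as its `k`-component the equation that
  -- characterizes `f k`; this serves both existence and uniqueness.
  have hπ : ∀ (g : Q ⟶ natHom (presheaf S d) P) (l : Lᵒᵖ) (k : Kᵒᵖ),
      ((coconeApp (mapCocone (nerve S) θ) l ⊗ₘ g) ≫
        natHomComp (presheaf S (T.obj l.unop)) (presheaf S d) P) ≫ natHomπ _ _ k =
      ((coconeApp θ l ≫ nerveApp S (T.obj l.unop) d k) ⊗ₘ (g ≫ natHomπ _ _ k)) ≫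
        eComp V ((presheaf S (T.obj l.unop)).obj k) ((presheaf S d).obj k) (P.obj k) := by
    intro g l k
    have hN : coconeApp (mapCocone (nerve S) θ) l =
      coconeApp θ l ≫ nerveMap S (T.obj l.unop) d := coconeApp_mapCocone _ θ l
    refine (congrArg (fun t => ((t ⊗ₘ g) ≫ natHomComp (presheaf S (T.obj l.unop)) (presheaf S d)
      P) ≫ natHomπ _ _ k) hN).trans ?_
    rw [Category.assoc, natHomComp_π, tensorHom_comp_tensorHom_assoc, Category.assoc, nerveMap_π]
  refine ⟨natHomLift _ _ f hnat, fun l => ?_, fun g hg => ?_⟩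
  · apply natHom_ext
    intro k
    refine (hπ (natHomLift _ _ f hnat) l k).trans ?_
    rw [natHomLift_π]
    exact hf' l k
  · apply natHom_ext
    intro k
    refine Eq.trans ?_ (natHomLift_π _ _ f hnat k).symm
    refine hu k _ fun l => ?_
    rw [happ]
    refine (hπ g l k).symm.trans ?_
    exact congrArg (fun t => t ≫ natHomπ (presheaf S (T.obj l.unop)) P k) (hg l)

end Pointwise

end WeightedColimits
end
end VCat

/-! ### Closure of the atoms -/

/-- For any class `Φ` of weights and any `V`-category `A`, the full subcategory `A_Φ` of `Φ`-atoms
is closed in `A` under those `Φ⁻`-colimits that exist in `A`. -/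
theorem proposition5p2 {V : Type v} [Category.{w} V] [MonoidalCategory V]
    [SymmetricCategory V] [MonoidalClosed V] [HasLimits V] [HasColimits V]
    (Φ : VCat.WeightClass V) (A : Type u) [EnrichedCategory V A] :
    VCat.IsClosedUnderColimits (VCat.WeightClass.minus Φ) (fun a : A => VCat.IsAtom Φ a) := by
  intro K _ ψ hψ S hS c η hη L _ φ hφ T d θ hθ
  have hN := VCat.isWeightedColimit_mapCocone_nerve S (fun k => hS k L φ hφ T d θ hθ)
  have hW := hψ L φ hφ (T.comp V (VCat.nerve S)) _ _ hN
  have e : ∀ {X₀ X₁ X₂ X₃ X₄ : V} (p : X₀ ⟶ X₁) (q : X₁ ⟶ X₂) (r : X₂ ⟶ X₃) (s : X₃ ⟶ X₄),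
      p ≫ (q ≫ r) ≫ s = ((p ≫ q) ≫ r) ≫ s := by intros; simp only [Category.assoc]
  have hiso : ∀ a, IsIso (VCat.colimitComparison ψ S η a) := hη
  -- The isomorphisms are the comparisons at `T l` and at `d`, invertible because `c` is the
  -- `ψ`-colimit of `S`. Both side conditions are naturality of the comparison: precomposed with
  -- `T.map l m` for the diagrams, and with the leg of `θ` at `l` for the cocones.
  refine VCat.isWeightedColimit_of_iso (S := T.comp V (VCat.representable c))
    (S' := (T.comp V (VCat.nerve S)).comp V (VCat.weightedLimitFunctor ψ))
    (fun l => @asIso _ _ _ _ (VCat.colimitComparison ψ S η (T.obj l)) (hiso _))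
    (@asIso _ _ _ _ (VCat.colimitComparison ψ S η d) (hiso d)) (fun l m => ?_) (fun l => ?_) hW
  · have h := congrArg (fun t => T.map l m ≫ t)
      (VCat.colimitComparison_natural η (T.obj l) (T.obj m))
    exact (Category.assoc _ _ _).trans (h.trans (e _ _ _ _))
  · have h := congrArg (fun t => VCat.coconeApp θ l ≫ t)
      (VCat.colimitComparison_natural η (T.obj l.unop) d)
    have h₁ := VCat.coconeApp_mapCocone (VCat.representable c) θ l
    have h₂ := (VCat.coconeApp_mapCocone (VCat.weightedLimitFunctor ψ)
      (VCat.mapCocone (VCat.nerve S) θ) l).trans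
        (congrArg (fun t => t ≫ (VCat.weightedLimitFunctor ψ).map _ _)
          (VCat.coconeApp_mapCocone (VCat.nerve S) θ l))
    exact (congrArg (fun t => t ≫ (ihom (c ⟶[V] T.obj l.unop)).map
      (VCat.colimitComparison ψ S η d)) h₁).trans ((Category.assoc _ _ _).trans (h.trans
        ((e _ _ _ _).trans (congrArg (fun t => t ≫ (MonoidalClosed.pre
          (VCat.colimitComparison ψ S η (T.obj l.unop))).app _) h₂).symm)))
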